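/- **Setting.** Let $(\Omega,\mathcal A,\mathbb P)$ be a probability space, $(E,\mathcal T)$ a measurable space, and $X=(X_i)_{i\ge1}$ a stationary process on $\Omega$ with values in $E$. Let $T(x_1,x_2,\dots)=(x_2,x_3,\dots)$ be the shift on $E^{\mathbb N_+}$. Let $(\mathcal Y,\|\cdot\|)$ be a separable normed vector space, and for each $n\ge1$ let $S_n\Phi:E^{\mathbb N_+}\to\mathcal Y$ be measurable (product $\sigma$-field to Borel $\sigma$-field). Let $\mu_n$ be the law of $S_n\Phi(X)/n$. Let $(k(n))_{n\ge1}$ be an increasing sequence of positive integers (not necessarily strictly), and for $\omega\in\Omega$ put $$\mu_n^\omega=\frac1{k(n)}\sum_{j=1}^{k(n)}\delta_{x_{n,j}(\omega)},\qquad x_{n,j}(\omega)=\frac{S_n\Phi(T^{(j-1)n}X(\omega))}{n}.$$ **Large deviations.** Let $I:\mathcal Y\to[0,\infty]$ be lower semicontinuous, and let $\mathcal D_I=\{x:I(x)<\infty\}$. For a sequence $(\nu_n)_{n\ge1}$ of probability measures on $\mathcal Y$ and $\Gamma\subset\mathcal Y$ consider the two bounds (with $\log 0=-\infty$, $\inf\emptyset=+\infty$)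 $$\text{(L)}\ -\inf_{\mathring\Gamma}I\le\liminf_{n\to\infty}\frac1n\log\nu_n(\Gamma),\qquad \text{(U)}\ \limsup_{n\to\infty}\frac1n\log\nu_n(\Gamma)\le-\inf_{\overline\Gamma}I .$$ The sequence $(\nu_n)$ satisfies the LDP with rate function $I$ if (L) and (U) hold for every $\Gamma$ in the completed Borel $\sigma$-field (the sets measurable for the completion of every $\nu_n$). It satisfies the weak LDP with rate function $I$ if (L) holds for all such $\Gamma$ and (U) holds for all compact $\Gamma$. The rate function $I$ is good if $\{I\le a\}$ is compact for every $a\in[0,\infty)$. The sequence $(\nu_n)$ is exponentially tight if for every $a<\infty$ there is a compact $K$ with $\limsup_{n\to\infty}\frac1n\log\nu_n(K^c)\le-a$. **Mixing.** For sub-$\sigma$-fields $\mathcal U,\mathcal V$ of $\mathcal A$ let $\alpha(\mathcal U,\mathcal V)=\sup\{|\mathbb P(U)\mathbb P(V)-\mathbb P(U\cap V)|:U\in\mathcal U,V\in\mathcal V\}$. Put $\alpha_{X,0}=1/2$ and, for $m\ge1$, $\alpha_{X,m}=\sup_{i\ge1}\alpha\big(\sigma(X_k:k\le i),\sigma(X_j:j\ge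 i+m)\big)$. For $u\in[0,1]$ let $\alpha_X^{-1}(u)=\inf\{m\ge0:\alpha_{X,m}\le u\}\in[0,\infty]$. **Assumptions.** * (A1) $(\mu_n)_{n\ge1}$ satisfies the LDP with rate function $I$. * (A2) $\int_0^1(\alpha_X^{-1}(u))^h\,du<\infty$ for every $h>0$. * (A3) There are functions $S_n\Phi_n:E^{\mathbb N_+}\to\mathcal Y$, each depending only on the first $2n$ coordinates, such that $\sup_{z\in E^{\mathbb N_+}}\|S_n\Phi(z)-S_n\Phi_n(z)\|/n\to0$ as $n\to\infty$. **Theorem 2.2.** Assume (A1), (A2) and (A3). Suppose that either $\sup_{x\in\mathcal D_I}I(x)<\infty$ and $\liminf_{n\to\infty}\frac{\log k(n)}n>\sup_{x\in\mathcal D_I}I(x)$, or $\lim_{n\to\infty}\frac{\log k(n)}n=\infty$. Then for $\mathbb P$-almost every $\omega$ the sequence $(\mu_n^\omega)_{n\ge1}$ satisfies the weak LDP with rate function $I$. If, moreover, $(\mu_n)_{n\ge1}$ is exponentially tight, then $I$ is good and for $\mathbb P$-almost every $\omega$ the sequence $(\mu_n^\omega)_{n\ge1}$ satisfies the LDP with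 rate function $I$. -/

import Mathlib

open MeasureTheory Filter Topology
open scoped ENNReal

namespace LocalLDP

noncomputable section

/-! ### Large deviation principles

Sequences indexed by `n ≥ 1` are functions on `ℕ` whose value at `0` plays no role. -/

section LDP

variable {Y : Type*} [TopologicalSpace Y] [MeasurableSpace Y]

/-- `(1/n) log μ_n(Γ)` as an extended real number, with `log 0 = -∞`. -/
def logRate (μ : ℕ → Measure Y) (Γ : Set Y) (n : ℕ) : EReal :=
  ENNReal.log (μ n Γ) / (n : EReal)

/-- The completed Borel field: the sets that are measurable for the completion of every `μ_n`,
`n ≥ 1`. Every Borel set belongs to it. -/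
def InCompletedBorel (μ : ℕ → Measure Y) (Γ : Set Y) : Prop :=
  ∀ n, 1 ≤ n → NullMeasurableSet Γ (μ n)

/-- The large deviation lower bound `-inf_{int Γ} I ≤ liminf (1/n) log μ_n(Γ)`. -/
def LowerBound (μ : ℕ → Measure Y) (I : Y → ℝ≥0∞) (Γ : Set Y) : Prop :=
  -((⨅ x ∈ interior Γ, I x : ℝ≥0∞) : EReal) ≤ liminf (logRate μ Γ) atTop

/-- The large deviation upper bound `limsup (1/n) log μ_n(Γ) ≤ -inf_{cl Γ} I`. -/
def UpperBound (μ : ℕ → Measure Y) (I : Y → ℝ≥0∞) (Γ : Set Y) : Prop :=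
  limsup (logRate μ Γ) atTop ≤ -((⨅ x ∈ closure Γ, I x : ℝ≥0∞) : EReal)

/-- `(μ_n)` satisfies the LDP with rate function `I : Y → [0,∞]`. -/
structure SatisfiesLDP (μ : ℕ → Measure Y) (I : Y → ℝ≥0∞) : Prop where
  lsc : LowerSemicontinuous I
  lower : ∀ Γ, InCompletedBorel μ Γ → LowerBound μ I Γ
  upper : ∀ Γ, InCompletedBorel μ Γ → UpperBound μ I Γ

/-- `(μ_n)` satisfies the weak LDP with rate function `I`: the upper bound is required for compact
sets only. -/
structure SatisfiesWeakLDP (μ : ℕ → Measure Y) (I : Y → ℝ≥0∞) : Prop where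
  lsc : LowerSemicontinuous I
  lower : ∀ Γ, InCompletedBorel μ Γ → LowerBound μ I Γ
  upper : ∀ Γ, IsCompact Γ → UpperBound μ I Γ

/-- Goodness of a rate function: all level sets `{I ≤ a}`, `0 ≤ a < ∞`, are compact. -/
def IsGoodRate (I : Y → ℝ≥0∞) : Prop :=
  ∀ a : NNReal, IsCompact {x | I x ≤ (a : ℝ≥0∞)}

/-- Exponential tightness. -/
def ExponentiallyTight (μ : ℕ → Measure Y) : Prop :=
  ∀ a : ℝ, ∃ K : Set Y, IsCompact K ∧ limsup (logRate μ Kᶜ) atTop ≤ ((-a : ℝ) : EReal)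

end LDP

/-- The domain `{I < ∞}` of `I`. -/
def rateDomain {Y : Type*} (I : Y → ℝ≥0∞) : Set Y := {x | I x < ⊤}

/-! ### Stationary processes and mixing

The process `(X_i)_{i ≥ 1}` is `X : ℕ → Ω → E`, where `X i` stands for `X_{i+1}`. -/

section Mixing

variable {Ω E : Type*} [MeasurableSpace Ω] [MeasurableSpace E]

/-- The `m`-th iterate of the shift on sequences. -/
def shift (m : ℕ) (z : ℕ → E) : ℕ → E := fun i => z (i + m)

/-- The trajectory `X(ω)`. -/
def path (X : ℕ → Ω → E) (ω : Ω) : ℕ → E := fun i => X i ω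

/-- `X` is a (measurable) stationary process: the law of the shifted process on the product space
is that of `X`. -/
structure IsStationary (P : Measure Ω) (X : ℕ → Ω → E) : Prop where
  measurable : ∀ i, Measurable (X i)
  map_shift : ∀ m, P.map (fun ω => shift m (path X ω)) = P.map (path X)

/-- The α-mixing coefficient `sup |P(U) P(V) - P(U ∩ V)|` of two σ-algebras. -/
def alphaCoeff (P : Measure Ω) (𝒰 𝒱 : MeasurableSpace Ω) : ℝ≥0∞ :=
  ⨆ (U : Set Ω) (V : Set Ω) (_ : MeasurableSet[𝒰] U) (_ : MeasurableSet[𝒱] V),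
    ENNReal.ofReal |P.real U * P.real V - P.real (U ∩ V)|

/-- `σ(X_k : k ≤ i)`. -/
abbrev sigmaPast (X : ℕ → Ω → E) (i : ℕ) : MeasurableSpace Ω :=
  ⨆ (k : ℕ) (_ : k ≤ i), MeasurableSpace.comap (X k) inferInstance

/-- `σ(X_j : j ≥ i)`. -/
abbrev sigmaFuture (X : ℕ → Ω → E) (i : ℕ) : MeasurableSpace Ω :=
  ⨆ (j : ℕ) (_ : i ≤ j), MeasurableSpace.comap (X j) inferInstance

/-- The Rosenblatt mixing coefficients `α_{X,m}`, with `α_{X,0} = 1/2`. -/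
def alphaMixing (P : Measure Ω) (X : ℕ → Ω → E) (m : ℕ) : ℝ≥0∞ :=
  if m = 0 then 1 / 2 else ⨆ i : ℕ, alphaCoeff P (sigmaPast X i) (sigmaFuture X (i + m))

/-- `α_X⁻¹(u) = inf {m : α_{X,m} ≤ u}`, equal to `∞` if there is no such `m`. -/
def alphaInv (P : Measure Ω) (X : ℕ → Ω → E) (u : ℝ) : ℝ≥0∞ :=
  ⨅ (m : ℕ) (_ : alphaMixing P X m ≤ ENNReal.ofReal u), (m : ℝ≥0∞)

/-- `M_h = ∫₀¹ (α_X⁻¹(u))^h du`, a number in `[0,∞]`. -/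
def mixingMoment (P : Measure Ω) (X : ℕ → Ω → E) (h : ℝ) : ℝ≥0∞ :=
  ∫⁻ u in Set.Icc (0 : ℝ) 1, alphaInv P X u ^ h

/-! ### Laws and local empirical measures

`S n : (ℕ → E) → Y` is the function written `S_n Φ`. -/

variable {Y : Type*} [NormedAddCommGroup Y] [NormedSpace ℝ Y]

/-- `S_n Φ` is, up to a uniform error `o(n)`, a function of the first `2n` coordinates. -/
def UniformlyApproximable (S : ℕ → (ℕ → E) → Y) : Prop :=
  ∃ R : ℕ → (ℕ → E) → Y, (∀ n, DependsOn (R n) (Set.Iio (2 * n))) ∧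
    Tendsto (fun n : ℕ => ⨆ z : ℕ → E, ‖S n z - R n z‖ₑ / (n : ℝ≥0∞)) atTop (𝓝 0)

variable [MeasurableSpace Y]

/-- `μ_n`, the law of `S_n Φ(X) / n`. -/
def law (P : Measure Ω) (X : ℕ → Ω → E) (S : ℕ → (ℕ → E) → Y) (n : ℕ) : Measure Y :=
  P.map (fun ω => (n : ℝ)⁻¹ • S n (path X ω))

/-- `μ_n^ω = (1/k(n)) ∑_{1 ≤ j ≤ k(n)} δ_{S_n Φ(T^{(j-1)n} X(ω)) / n}`. -/
def empirical (k : ℕ → ℕ) (X : ℕ → Ω → E) (S : ℕ → (ℕ → E) → Y) (ω : Ω) (n : ℕ) : Measure Y :=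
  (k n : ℝ≥0∞)⁻¹ • ∑ j ∈ Finset.Icc 1 (k n),
    Measure.dirac ((n : ℝ)⁻¹ • S n (shift ((j - 1) * n) (path X ω)))

end Mixing

end

end LocalLDP

/-!
For the upper bound, `∫ μ_n^ω(B) dP ≤ μ_n(B)` by stationarity, so Markov's inequality and
Borel–Cantelli bound the exponential growth of `μ_n^ω(B)` by that of `μ_n(B)`, almost surely and
simultaneously for all `B` in a countable basis; finitely many such `B` cover a compact set.

For the lower bound, (A3) reduces to functions of `2n` coordinates. Blocks at a distance of at
least `m + 2` are then separated by `m` time steps, and the second moment method gives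
`P(μ_n^ω(B) ≤ μ_n(B) / 2) ≲ m / (k(n) μ_n(B)) + α_{X,m} / μ_n(B)²`. When `-log μ_n(B)` grows more
slowly than `log k(n)`, the choice `m = ⌈exp(δ n)⌉` with `δ` small makes this summable, because
(A2) makes `α_{X,m}` decay faster than any power of `m`.
-/

namespace LocalLDP

open ExpGrowth ProbabilityTheory

section ExponentialGrowth

theorem expGrowthSup_div_le {u v : ℕ → ℝ≥0∞} (h : expGrowthSup u ≠ ⊥ ∨ expGrowthInf v ≠ ⊥)
    (h' : expGrowthSup u ≠ ⊤ ∨ expGrowthInf v ≠ ⊤) :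
    expGrowthSup (fun n => u n / v n) ≤ expGrowthSup u - expGrowthInf v := by
  rw [sub_eq_add_neg, ← expGrowthSup_inv]
  exact expGrowthSup_mul_le (v := v⁻¹)
    (by simpa only [expGrowthSup_inv, Ne, EReal.neg_eq_top_iff] using h)
    (by simpa only [expGrowthSup_inv, Ne, EReal.neg_eq_bot_iff] using h')

theorem expGrowthSup_natCast_ceil_exp_le {δ : ℝ} (hδ : 0 ≤ δ) :
    expGrowthSup (fun n : ℕ => (⌈Real.exp (δ * n)⌉₊ : ℝ≥0∞)) ≤ δ := by
  rw [← expGrowthSup_exp (a := (δ : EReal))]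
  refine expGrowthSup_le_of_eventually_le (b := 2) (by simp) (Eventually.of_forall fun n => ?_)
  have h_one : 1 ≤ Real.exp (δ * n) := Real.one_le_exp (by positivity)
  have h_ceil : (⌈Real.exp (δ * n)⌉₊ : ℝ) ≤ 2 * Real.exp (δ * n) := by
    linarith [Nat.ceil_lt_add_one (Real.exp_pos (δ * n)).le]
  have h_ofReal := ENNReal.ofReal_le_ofReal h_ceil
  rwa [ENNReal.ofReal_natCast, ENNReal.ofReal_mul zero_le_two, ENNReal.ofReal_ofNat,
    ← EReal.exp_coe, EReal.coe_mul, EReal.coe_natCast] at h_ofReal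

variable {Ω : Type*} [MeasurableSpace Ω] {μ : Measure Ω}

theorem ae_eventually_notMem_of_expGrowthSup_neg [IsFiniteMeasure μ] {s : ℕ → Set Ω}
    (hs : expGrowthSup (fun n => μ (s n)) < 0) : ∀ᵐ ω ∂μ, ∀ᶠ n in atTop, ω ∉ s n := by
  obtain ⟨c, hsc, hc⟩ := EReal.lt_iff_exists_real_btwn.1 hs
  obtain ⟨N, hN⟩ := eventually_atTop.1 (eventually_le_exp hsc)
  have hr : EReal.exp c < 1 := EReal.exp_lt_one_iff.2 hc
  have hsum : ∑' n, μ (s (n + N)) ≠ ⊤ := by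
    refine ne_top_of_le_ne_top ?_ (ENNReal.tsum_le_tsum fun n =>
      (hN (n + N) (Nat.le_add_left N n)).trans_eq (by rw [mul_comm, EReal.exp_nmul, pow_add]))
    rw [ENNReal.tsum_mul_right, ENNReal.tsum_geometric]
    exact ENNReal.mul_ne_top (ENNReal.inv_ne_top.2 (tsub_pos_of_lt hr).ne')
      (ENNReal.pow_ne_top hr.ne_top)
  filter_upwards [ae_eventually_notMem hsum] with ω hω
  rwa [← map_add_atTop_eq_nat N, eventually_map]

theorem ae_expGrowthSup_le_expGrowthSup_lintegral [IsFiniteMeasure μ] {f : ℕ → Ω → ℝ≥0∞}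
    (hf : ∀ᶠ n in atTop, AEMeasurable (f n) μ) :
    ∀ᵐ ω ∂μ, expGrowthSup (fun n => f n ω) ≤ expGrowthSup (fun n => ∫⁻ ω, f n ω ∂μ) := by
  set g := expGrowthSup fun n => ∫⁻ ω, f n ω ∂μ
  have h_rat (q : ℚ) (hq : g < (q : ℝ)) :
      ∀ᵐ ω ∂μ, ∀ᶠ n : ℕ in atTop, ω ∉ {ω | EReal.exp ((q : ℝ) * n) ≤ f n ω} := by
    apply ae_eventually_notMem_of_expGrowthSup_neg
    have h_markov : (fun n : ℕ => μ {ω | EReal.exp ((q : ℝ) * n) ≤ f n ω}) ≤ᶠ[atTop]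
        (fun n => ∫⁻ ω, f n ω ∂μ) * fun n : ℕ => EReal.exp (((-q : ℝ) : EReal) * n) := by
      filter_upwards [hf] with n hfn
      refine (meas_ge_le_lintegral_div hfn
        (by simp [EReal.mul_eq_bot, EReal.natCast_ne_bot, EReal.natCast_ne_top])
        (by simp [EReal.mul_eq_top, EReal.natCast_ne_bot, EReal.natCast_ne_top])).trans_eq ?_
      simp only [Pi.mul_apply, div_eq_mul_inv, ← EReal.exp_neg, EReal.coe_neg, EReal.neg_mul]
    refine (expGrowthSup_eventually_monotone h_markov).trans_lt ?_
    refine (expGrowthSup_mul_le ?_ ?_).trans_lt ?_ <;> rw [expGrowthSup_exp]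
    · simp
    · simp
    · exact EReal.sub_neg (by simp) (by simp) |>.2 hq
  have h_all : ∀ᵐ ω ∂μ, ∀ q : ℚ, g < (q : ℝ) →
      ∀ᶠ n : ℕ in atTop, ω ∉ {ω | EReal.exp ((q : ℝ) * n) ≤ f n ω} := by
    rw [ae_all_iff]
    exact fun q => ae_all_iff.2 (h_rat q)
  filter_upwards [h_all] with ω hω
  refine le_of_forall_gt_imp_ge_of_dense fun b hb => ?_
  obtain ⟨q, hgq, hqb⟩ := EReal.lt_iff_exists_rat_btwn.1 hb
  refine le_trans (Eventually.expGrowthSup_le ?_) hqb.le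
  filter_upwards [hω q hgq] with n hn
  exact (not_le.1 hn).le

end ExponentialGrowth

theorem le_coe_biInf_iff {α : Type*} {s : Set α} {I : α → ℝ≥0∞} {b : EReal} :
    b ≤ ((⨅ x ∈ s, I x : ℝ≥0∞) : EReal) ↔ ∀ x ∈ s, b ≤ I x := by
  refine ⟨fun h x hx => h.trans (EReal.coe_ennreal_le_coe_ennreal_iff.2 (biInf_le I hx)),
    fun h => ?_⟩
  rcases le_total b 0 with hb | hb
  · exact hb.trans (EReal.coe_ennreal_nonneg _)
  · rw [← EReal.coe_toENNReal hb, EReal.coe_ennreal_le_coe_ennreal_iff]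
    exact le_iInf₂ fun x hx => EReal.coe_ennreal_le_coe_ennreal_iff.1
      ((EReal.coe_toENNReal hb).trans_le (h x hx))

section LargeDeviations

theorem expGrowthSup_measure_union_le {α : Type*} [MeasurableSpace α] (ν : ℕ → Measure α)
    (s t : Set α) :
    expGrowthSup (fun n => ν n (s ∪ t)) ≤
      expGrowthSup (fun n => ν n s) ⊔ expGrowthSup (fun n => ν n t) :=
  (expGrowthSup_monotone fun _ => measure_union_le s t).trans_eq expGrowthSup_add

variable {Y : Type*} [TopologicalSpace Y] [MeasurableSpace Y] {ν : ℕ → Measure Y} {I : Y → ℝ≥0∞}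

theorem lowerBound_iff {Γ : Set Y} :
    LowerBound ν I Γ ↔ ∀ x ∈ interior Γ, -(I x : EReal) ≤ expGrowthInf (fun n => ν n Γ) := by
  rw [LowerBound, EReal.neg_le, le_coe_biInf_iff]
  exact forall₂_congr fun x _ => EReal.neg_le

theorem upperBound_iff {Γ : Set Y} :
    UpperBound ν I Γ ↔ ∀ c : EReal, c < ((⨅ x ∈ closure Γ, I x : ℝ≥0∞) : EReal) →
      expGrowthSup (fun n => ν n Γ) ≤ -c := by
  rw [UpperBound, EReal.le_neg]
  simp only [EReal.le_neg (a := expGrowthSup _)]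
  exact ⟨fun h c hc => hc.le.trans h, le_of_forall_lt_imp_le_of_dense⟩

theorem UpperBound.expGrowthSup_le {Γ : Set Y} (h : UpperBound ν I Γ) {c : EReal}
    (hc : ∀ x ∈ closure Γ, c ≤ I x) : expGrowthSup (fun n => ν n Γ) ≤ -c :=
  h.trans (EReal.neg_le_neg_iff.2 (le_coe_biInf_iff.2 hc))

theorem upperBound_of_isCompact [RegularSpace Y] {ℬ : Set (Set Y)}
    (hℬ : TopologicalSpace.IsTopologicalBasis ℬ) (hI : LowerSemicontinuous I)
    (hν : ∀ B ∈ ℬ, UpperBound ν I B) {K : Set Y} (hK : IsCompact K) : UpperBound ν I K := by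
  refine upperBound_iff.2 fun c hc => ?_
  have hcK : ∀ x ∈ K, c < I x := fun x hx =>
    hc.trans_le (le_coe_biInf_iff.1 le_rfl x (subset_closure hx))
  have hopen : IsOpen {x | c < (I x : EReal)} :=
    (continuous_coe_ennreal_ereal.comp_lowerSemicontinuous hI
      EReal.coe_ennreal_strictMono.monotone).isOpen_preimage c
  refine hK.induction_on (p := fun s => expGrowthSup (fun n => ν n s) ≤ -c) ?_
    (fun s t hst ht => (expGrowthSup_monotone fun n => measure_mono hst).trans ht)
    (fun s t hs ht => (expGrowthSup_measure_union_le ν s t).trans (sup_le hs ht)) fun x hx => ?_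
  · simp only [measure_empty]
    exact expGrowthSup_zero.trans_le bot_le
  · obtain ⟨B, hB, hxB, hBc⟩ := hℬ.exists_closure_subset (hopen.mem_nhds (hcK x hx))
    exact ⟨B, mem_nhdsWithin_of_mem_nhds ((hℬ.isOpen hB).mem_nhds hxB),
      (hν B hB).expGrowthSup_le fun y hy => (hBc hy).le⟩

theorem SatisfiesWeakLDP.satisfiesLDP (h : SatisfiesWeakLDP ν I) (hν : ExponentiallyTight ν) :
    SatisfiesLDP ν I where
  lsc := h.lsc
  lower := h.lower
  upper Γ _ := by
    refine upperBound_iff.2 fun c hc => ?_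
    obtain ⟨a, hca, -⟩ := EReal.lt_iff_exists_real_btwn.1 (hc.trans_le le_top)
    obtain ⟨K, hK, hKa⟩ := hν a
    have h_compact : expGrowthSup (fun n => ν n (closure Γ ∩ K)) ≤ -c :=
      (h.upper _ (hK.inter_left isClosed_closure)).expGrowthSup_le fun x hx =>
        hc.le.trans (le_coe_biInf_iff.1 le_rfl x
          (closure_minimal Set.inter_subset_left isClosed_closure hx))
    have h_tail : expGrowthSup (fun n => ν n Kᶜ) ≤ -c :=
      hKa.trans (EReal.neg_le_neg_iff.2 hca.le)
    have h_cover : Γ ⊆ closure Γ ∩ K ∪ Kᶜ := fun x hx =>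
      (em (x ∈ K)).imp (fun hxK => ⟨subset_closure hx, hxK⟩) id
    exact (expGrowthSup_monotone fun n => measure_mono h_cover).trans
      ((expGrowthSup_measure_union_le ν _ _).trans (sup_le h_compact h_tail))

theorem ExponentiallyTight.isGoodRate [T2Space Y] (hν : ExponentiallyTight ν)
    (hI : LowerSemicontinuous I) (hlower : ∀ U, IsOpen U → LowerBound ν I U) : IsGoodRate I := by
  intro a
  obtain ⟨K, hK, hKa⟩ := hν (a + 1)
  refine hK.of_isClosed_subset (hI.isClosed_preimage _) fun x (hx : I x ≤ a) => ?_
  by_contra hxK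
  have h_lower : -(I x : EReal) ≤ expGrowthInf (fun n => ν n Kᶜ) :=
    lowerBound_iff.1 (hlower Kᶜ hK.isClosed.isOpen_compl) x
      (by rwa [hK.isClosed.isOpen_compl.interior_eq])
  have h_growth := h_lower.trans (expGrowthInf_le_expGrowthSup.trans hKa)
  rw [EReal.coe_neg, EReal.neg_le_neg_iff] at h_growth
  have h_le : ((a + 1 : ℝ) : EReal) ≤ (a : ℝ) :=
    h_growth.trans (EReal.coe_ennreal_le_coe_ennreal_iff.2 hx)
  linarith [EReal.coe_le_coe_iff.1 h_le]

end LargeDeviations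

section Mixing

variable {Ω E : Type*} [MeasurableSpace Ω] [MeasurableSpace E] {P : Measure Ω} {X : ℕ → Ω → E}

theorem sigmaFuture_le (hX : ∀ i, Measurable (X i)) (i : ℕ) :
    sigmaFuture X i ≤ ‹MeasurableSpace Ω› :=
  iSup₂_le fun k _ => (hX k).comap_le

theorem ofReal_abs_le_alphaMixing {i j m : ℕ} (hm : m ≠ 0) (hij : i + m ≤ j) {U V : Set Ω}
    (hU : MeasurableSet[sigmaPast X i] U) (hV : MeasurableSet[sigmaFuture X j] V) :
    ENNReal.ofReal |P.real U * P.real V - P.real (U ∩ V)| ≤ alphaMixing P X m := by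
  have h_future : sigmaFuture X j ≤ sigmaFuture X (i + m) :=
    iSup₂_le fun l hl => le_iSup₂_of_le l (hij.trans hl) le_rfl
  rw [alphaMixing, if_neg hm]
  refine le_iSup_of_le i ?_
  exact le_iSup₂_of_le U V (le_iSup₂_of_le hU (h_future V hV) le_rfl)

theorem abs_mul_sub_real_inter_le [IsProbabilityMeasure P] (U : Set Ω) {V : Set Ω}
    (hV : MeasurableSet V) : |P.real U * P.real V - P.real (U ∩ V)| ≤ 1 / 2 := by
  have h_union := measureReal_union_add_inter (μ := P) (s := U) hV
  have hU_le : P.real (U ∩ V) ≤ P.real U := measureReal_mono Set.inter_subset_left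
  have hV_le : P.real (U ∩ V) ≤ P.real V := measureReal_mono Set.inter_subset_right
  have h_one : P.real (U ∪ V) ≤ 1 := measureReal_le_one
  have h_nonneg : 0 ≤ P.real (U ∩ V) := measureReal_nonneg
  rw [abs_le]
  constructor <;> nlinarith [sq_nonneg (P.real U - P.real V),
    measureReal_le_one (μ := P) (s := U), measureReal_le_one (μ := P) (s := V)]

theorem antitone_alphaMixing [IsProbabilityMeasure P] (hX : ∀ i, Measurable (X i)) :
    Antitone (alphaMixing P X) := by
  intro m l hml
  rcases eq_or_ne l 0 with rfl | hl
  · rw [Nat.le_zero.1 hml]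
  rw [alphaMixing, if_neg hl]
  refine iSup_le fun i => iSup₂_le fun U V => iSup₂_le fun hU hV => ?_
  rcases eq_or_ne m 0 with rfl | hm
  · rw [alphaMixing, if_pos rfl]
    exact ENNReal.ofReal_le_of_le_toReal
      ((abs_mul_sub_real_inter_le U (sigmaFuture_le hX _ V hV)).trans (by norm_num))
  · exact ofReal_abs_le_alphaMixing hm (Nat.add_le_add_left hml i) hU hV

theorem alphaMixing_le_half [IsProbabilityMeasure P] (hX : ∀ i, Measurable (X i)) (m : ℕ) :
    alphaMixing P X m ≤ 1 / 2 :=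
  (antitone_alphaMixing hX m.zero_le).trans_eq (if_pos rfl)

theorem rpow_mul_alphaMixing_le [IsProbabilityMeasure P] (hX : ∀ i, Measurable (X i)) (m : ℕ)
    {h : ℝ} (hh : 0 ≤ h) : (m : ℝ≥0∞) ^ h * alphaMixing P X m ≤ mixingMoment P X h := by
  set a := (alphaMixing P X m).toReal
  have ha_ofReal : ENNReal.ofReal a = alphaMixing P X m :=
    ENNReal.ofReal_toReal ((alphaMixing_le_half hX m).trans_lt (by norm_num)).ne
  have ha_one : a ≤ 1 := ENNReal.toReal_le_of_le_ofReal zero_le_one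
    ((alphaMixing_le_half hX m).trans (by norm_num))
  have h_inv : ∀ u ∈ Set.Ico 0 a, (m : ℝ≥0∞) ≤ alphaInv P X u := fun u hu => by
    refine le_iInf₂ fun l hl => Nat.cast_le.2 (not_lt.1 fun hlm => hl.not_gt ?_)
    refine lt_of_lt_of_le ?_ (antitone_alphaMixing hX hlm.le)
    rw [← ha_ofReal]
    exact ENNReal.ofReal_lt_ofReal_iff_of_nonneg hu.1 |>.2 hu.2
  calc (m : ℝ≥0∞) ^ h * alphaMixing P X m
      = ∫⁻ _ in Set.Ico 0 a, (m : ℝ≥0∞) ^ h := by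
        rw [setLIntegral_const, Real.volume_Ico, sub_zero, ha_ofReal]
    _ ≤ ∫⁻ u in Set.Ico 0 a, alphaInv P X u ^ h :=
        setLIntegral_mono' measurableSet_Ico fun u hu => ENNReal.rpow_le_rpow (h_inv u hu) hh
    _ ≤ mixingMoment P X h :=
        lintegral_mono_set fun u hu => ⟨hu.1, hu.2.le.trans ha_one⟩

theorem expGrowthSup_alphaMixing_ceil_exp [IsProbabilityMeasure P] (hX : ∀ i, Measurable (X i))
    (hmix : ∀ h : ℝ, 0 < h → mixingMoment P X h < ⊤) {δ : ℝ} (hδ : 0 < δ) :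
    expGrowthSup (fun n : ℕ => alphaMixing P X ⌈Real.exp (δ * n)⌉₊) = ⊥ := by
  have h_le (h : ℝ) (hh : 0 < h) :
      expGrowthSup (fun n : ℕ => alphaMixing P X ⌈Real.exp (δ * n)⌉₊) ≤
        ((-(h * δ) : ℝ) : EReal) := by
    rw [← expGrowthSup_exp (a := ((-(h * δ) : ℝ) : EReal))]
    refine expGrowthSup_le_of_eventually_le (hmix h hh).ne (Eventually.of_forall fun n => ?_)
    have h_ceil : EReal.exp ((δ * n : ℝ) : EReal) ≤ (⌈Real.exp (δ * n)⌉₊ : ℝ≥0∞) := by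
      rw [EReal.exp_coe, ← ENNReal.ofReal_natCast]
      exact ENNReal.ofReal_le_ofReal (Nat.le_ceil _)
    have h_exp : EReal.exp (((-(h * δ) : ℝ) : EReal) * n) =
        (EReal.exp ((δ * n : ℝ) : EReal) ^ h)⁻¹ := by
      rw [← EReal.exp_mul, ← EReal.exp_neg]
      congr 1
      norm_cast
      ring
    rw [h_exp, ← div_eq_mul_inv, ENNReal.le_div_iff_mul_le
      (.inl (by simp [Real.exp_pos, -EReal.coe_mul])) (.inr (hmix h hh).ne), mul_comm]
    exact (mul_le_mul_left (ENNReal.rpow_le_rpow h_ceil hh.le) _).trans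
      (rpow_mul_alphaMixing_le hX _ hh.le)
  refine EReal.eq_bot_iff_forall_lt _ |>.2 fun b => ?_
  have hb : 0 < |b| / δ + 1 := by positivity
  refine (h_le _ hb).trans_lt (EReal.coe_lt_coe_iff.2 ?_)
  rw [add_mul, div_mul_cancel₀ _ hδ.ne']
  linarith [neg_abs_le b]

end Mixing

section SecondMoment

variable {Ω : Type*} [MeasurableSpace Ω] {P : Measure Ω} [IsProbabilityMeasure P]

theorem memLp_indicator_one {A : Set Ω} (hA : MeasurableSet A) :
    MemLp (A.indicator (1 : Ω → ℝ)) 2 P :=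
  memLp_indicator_const 2 hA 1 (.inr (measure_ne_top P A))

theorem covariance_indicator_one {A B : Set Ω} (hA : MeasurableSet A) (hB : MeasurableSet B) :
    cov[A.indicator (1 : Ω → ℝ), B.indicator 1; P] = P.real (A ∩ B) - P.real A * P.real B := by
  rw [covariance_eq_sub (memLp_indicator_one hA) (memLp_indicator_one hB),
    ← Set.inter_indicator_one, integral_indicator_one (hA.inter hB), integral_indicator_one hA,
    integral_indicator_one hB]

variable {A : ℕ → Set Ω} {s : Finset ℕ} {L : ℕ} {c : ℝ}

theorem sum_covariance_indicator_one_le (hA : ∀ j ∈ s, MeasurableSet (A j)) (hc0 : 0 ≤ c)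
    (hc : ∀ i ∈ s, ∀ j ∈ s, i + L ≤ j → P.real (A i ∩ A j) - P.real (A i) * P.real (A j) ≤ c)
    {i : ℕ} (hi : i ∈ s) :
    ∑ j ∈ s, cov[(A i).indicator (1 : Ω → ℝ), (A j).indicator 1; P] ≤
      2 * L * P.real (A i) + s.card * c := by
  have h_pair : ∀ j ∈ s, cov[(A i).indicator (1 : Ω → ℝ), (A j).indicator 1; P] ≤
      (if j ∈ Finset.Ico (i + 1 - L) (i + L) then P.real (A i) else 0) + c := fun j hj => by
    rw [covariance_indicator_one (hA i hi) (hA j hj)]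
    split_ifs with h_near
    · have h_inter : P.real (A i ∩ A j) ≤ P.real (A i) := measureReal_mono Set.inter_subset_left
      have h_prod : 0 ≤ P.real (A i) * P.real (A j) := by positivity
      linarith
    · rw [zero_add]
      rcases le_or_gt (i + L) j with h_far | h_far
      · exact hc i hi j hj h_far
      · rw [Set.inter_comm, mul_comm]
        exact hc j hj i hi (by simp only [Finset.mem_Ico] at h_near; lia)
  have h_card : (s.filter (· ∈ Finset.Ico (i + 1 - L) (i + L))).card ≤ 2 * L :=
    (Finset.card_le_card (t := Finset.Ico (i + 1 - L) (i + L)) fun j hj =>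
      (Finset.mem_filter.1 hj).2).trans (by rw [Nat.card_Ico]; lia)
  calc ∑ j ∈ s, cov[(A i).indicator (1 : Ω → ℝ), (A j).indicator 1; P]
      ≤ ∑ j ∈ s, ((if j ∈ Finset.Ico (i + 1 - L) (i + L) then P.real (A i) else 0) + c) :=
        Finset.sum_le_sum h_pair
    _ = (s.filter (· ∈ Finset.Ico (i + 1 - L) (i + L))).card * P.real (A i) + s.card * c := by
        rw [Finset.sum_add_distrib, ← Finset.sum_filter, Finset.sum_const, Finset.sum_const,
          nsmul_eq_mul, nsmul_eq_mul]
    _ ≤ 2 * L * P.real (A i) + s.card * c := by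
        gcongr
        exact_mod_cast h_card

theorem variance_sum_indicator_one_le (hA : ∀ j ∈ s, MeasurableSet (A j)) (hc0 : 0 ≤ c)
    (hc : ∀ i ∈ s, ∀ j ∈ s, i + L ≤ j → P.real (A i ∩ A j) - P.real (A i) * P.real (A j) ≤ c) :
    Var[∑ i ∈ s, (A i).indicator (1 : Ω → ℝ); P] ≤
      2 * L * ∑ i ∈ s, P.real (A i) + s.card ^ 2 * c := by
  rw [variance_sum' fun i hi => memLp_indicator_one (hA i hi)]
  refine (Finset.sum_le_sum fun i hi => sum_covariance_indicator_one_le hA hc0 hc hi).trans_eq ?_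
  rw [Finset.sum_add_distrib, ← Finset.mul_sum, Finset.sum_const, nsmul_eq_mul]
  ring

theorem measure_sum_indicator_one_le_half (hA : ∀ j ∈ s, MeasurableSet (A j)) (hc0 : 0 ≤ c)
    (hc : ∀ i ∈ s, ∀ j ∈ s, i + L ≤ j → P.real (A i ∩ A j) - P.real (A i) * P.real (A j) ≤ c)
    {p : ℝ} (hp : ∀ j ∈ s, P.real (A j) = p) (hp0 : 0 < p) (hs : s.Nonempty) :
    P {ω | (∑ j ∈ s, (A j).indicator (1 : Ω → ℝ)) ω ≤ s.card * p / 2} ≤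
      8 * L / (s.card * ENNReal.ofReal p) + 4 * ENNReal.ofReal c / ENNReal.ofReal p ^ 2 := by
  set N := ∑ j ∈ s, (A j).indicator (1 : Ω → ℝ) with hN
  have hs0 : (0 : ℝ) < s.card := by exact_mod_cast hs.card_pos
  have h_sum : ∑ j ∈ s, P.real (A j) = s.card * p := by
    rw [Finset.sum_congr rfl hp, Finset.sum_const, nsmul_eq_mul]
  have h_mean : ∫ ω, N ω ∂P = s.card * p := by
    simp only [hN, Finset.sum_apply]
    rw [integral_finsetSum s fun j hj => (memLp_indicator_one (hA j hj)).integrable one_le_two,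
      ← h_sum]
    exact Finset.sum_congr rfl fun j hj => integral_indicator_one (hA j hj)
  have h_memLp : MemLp N 2 P := memLp_finsetSum' s fun j hj => memLp_indicator_one (hA j hj)
  have h_half : 0 < s.card * p / 2 := by positivity
  calc P {ω | N ω ≤ s.card * p / 2}
      ≤ P {ω | s.card * p / 2 ≤ |N ω - ∫ ω, N ω ∂P|} := by
        refine measure_mono fun ω (hω : N ω ≤ s.card * p / 2) => ?_
        change s.card * p / 2 ≤ |N ω - ∫ ω, N ω ∂P|
        rw [h_mean, abs_sub_comm]
        linarith [le_abs_self (s.card * p - N ω)]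
    _ ≤ ENNReal.ofReal (Var[N; P] / (s.card * p / 2) ^ 2) :=
        meas_ge_le_variance_div_sq h_memLp h_half
    _ ≤ ENNReal.ofReal ((2 * L * (s.card * p) + s.card ^ 2 * c) / (s.card * p / 2) ^ 2) := by
        rw [← h_sum]
        gcongr
        exact variance_sum_indicator_one_le hA hc0 hc
    _ = ENNReal.ofReal (8 * L / (s.card * p) + 4 * c / p ^ 2) := by
        congr 1
        field_simp
        ring
    _ = 8 * L / (s.card * ENNReal.ofReal p) + 4 * ENNReal.ofReal c / ENNReal.ofReal p ^ 2 := by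
        rw [ENNReal.ofReal_add (by positivity) (by positivity),
          ENNReal.ofReal_div_of_pos (by positivity), ENNReal.ofReal_div_of_pos (by positivity),
          ENNReal.ofReal_mul hs0.le, ENNReal.ofReal_mul (by norm_num),
          ENNReal.ofReal_mul (by norm_num), ENNReal.ofReal_pow hp0.le, ENNReal.ofReal_natCast,
          ENNReal.ofReal_natCast, ENNReal.ofReal_ofNat, ENNReal.ofReal_ofNat]

end SecondMoment

theorem measurable_comp_of_dependsOn {Ω ι E Y : Type*} [MeasurableSpace Ω] [MeasurableSpace E]
    [MeasurableSpace Y] {f : (ι → E) → Y} (hf : Measurable f) {s : Set ι} (hfs : DependsOn f s)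
    {Z : Ω → ι → E} (hZ : ∀ i ∈ s, Measurable fun ω => Z ω i) : Measurable fun ω => f (Z ω) := by
  classical
  rcases isEmpty_or_nonempty Ω with hΩ | ⟨⟨ω₀⟩⟩
  · exact measurable_of_empty _
  have h_eq : (fun ω => f (Z ω)) = fun ω => f (s.piecewise (Z ω) (Z ω₀)) :=
    funext fun ω => hfs fun i hi => (s.piecewise_eq_of_mem _ _ hi).symm
  rw [h_eq]
  refine hf.comp (measurable_pi_lambda _ fun i => ?_)
  by_cases hi : i ∈ s
  · simpa only [s.piecewise_eq_of_mem _ _ hi] using hZ i hi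
  · simp only [s.piecewise_eq_of_notMem _ _ hi, measurable_const]

section Empirical

variable {Ω E Y : Type*} [NormedAddCommGroup Y] [NormedSpace ℝ Y] [MeasurableSpace Y]
  {X : ℕ → Ω → E} {R S : ℕ → (ℕ → E) → Y} {k : ℕ → ℕ} {n : ℕ}

/-- The variable `x_{n,j}(ω) = S_n Φ(T^{(j-1)n} X(ω)) / n`, for `j ≥ 1`. -/
noncomputable def blockAverage (X : ℕ → Ω → E) (S : ℕ → (ℕ → E) → Y) (n j : ℕ) (ω : Ω) : Y :=
  (n : ℝ)⁻¹ • S n (shift ((j - 1) * n) (path X ω))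

theorem empirical_apply (ω : Ω) {B : Set Y} (hB : MeasurableSet B) :
    empirical k X S ω n B =
      (k n : ℝ≥0∞)⁻¹ * ∑ j ∈ Finset.Icc 1 (k n), B.indicator 1 (blockAverage X S n j ω) := by
  simp only [empirical, Measure.smul_apply, Measure.finsetSum_apply, Measure.dirac_apply' _ hB,
    smul_eq_mul, blockAverage]

theorem toReal_empirical_apply (ω : Ω) {B : Set Y} (hB : MeasurableSet B) :
    (empirical k X S ω n B).toReal = (k n : ℝ)⁻¹ *
      (∑ j ∈ Finset.Icc 1 (k n), (blockAverage X S n j ⁻¹' B).indicator (1 : Ω → ℝ)) ω := by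
  have h_indicator (j : ℕ) : B.indicator (1 : Y → ℝ≥0∞) (blockAverage X S n j ω) =
      ENNReal.ofReal ((blockAverage X S n j ⁻¹' B).indicator 1 ω) := by
    by_cases h : blockAverage X S n j ω ∈ B <;> simp [h]
  rw [empirical_apply ω hB, ENNReal.toReal_mul, ENNReal.toReal_inv, ENNReal.toReal_natCast,
    Finset.sum_apply]
  simp only [h_indicator]
  rw [ENNReal.toReal_sum fun j _ => ENNReal.ofReal_ne_top]
  congr 1
  exact Finset.sum_congr rfl fun j _ =>
    ENNReal.toReal_ofReal (Set.indicator_nonneg (fun _ _ => zero_le_one) _)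

theorem empirical_le_empirical_thickening [OpensMeasurableSpace Y] {ε : ℝ}
    (hRS : ∀ z, dist ((n : ℝ)⁻¹ • R n z) ((n : ℝ)⁻¹ • S n z) < ε) (ω : Ω) {U : Set Y}
    (hU : MeasurableSet U) :
    empirical k X R ω n U ≤ empirical k X S ω n (Metric.thickening ε U) := by
  rw [empirical_apply ω hU, empirical_apply ω Metric.isOpen_thickening.measurableSet]
  refine mul_le_mul_right (Finset.sum_le_sum fun j _ => ?_) _
  refine Set.indicator_apply_le' (fun hj => ?_) fun _ => zero_le
  have h_mem : blockAverage X S n j ω ∈ Metric.thickening ε U :=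
    Metric.mem_thickening_iff.2 ⟨_, hj, (dist_comm _ _).trans_lt (hRS _)⟩
  rw [Set.indicator_of_mem h_mem, Pi.one_apply, Pi.one_apply]

variable [BorelSpace Y] [MeasurableSpace Ω] [MeasurableSpace E] {P : Measure Ω}

theorem measurable_blockAverage (hX : ∀ i, Measurable (X i)) (hS : Measurable (S n)) (j : ℕ) :
    Measurable (blockAverage X S n j) :=
  (hS.comp (measurable_pi_lambda _ fun i => hX (i + (j - 1) * n))).const_smul _

theorem map_blockAverage (hX : IsStationary P X) (hS : Measurable (S n)) (j : ℕ) :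
    P.map (blockAverage X S n j) = law P X S n := by
  have h_scaled : Measurable fun z => (n : ℝ)⁻¹ • S n z := hS.const_smul _
  have h_path : Measurable (path X) := measurable_pi_lambda _ hX.measurable
  have h_shift : Measurable fun ω => shift ((j - 1) * n) (path X ω) :=
    measurable_pi_lambda _ fun i => hX.measurable _
  calc P.map (blockAverage X S n j)
      = (P.map fun ω => shift ((j - 1) * n) (path X ω)).map fun z => (n : ℝ)⁻¹ • S n z :=
        (Measure.map_map h_scaled h_shift).symm
    _ = law P X S n := by rw [hX.map_shift, Measure.map_map h_scaled h_path]; rfl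

theorem measure_blockAverage_preimage (hX : IsStationary P X) (hS : Measurable (S n)) (j : ℕ)
    {B : Set Y} (hB : MeasurableSet B) : P (blockAverage X S n j ⁻¹' B) = law P X S n B := by
  rw [← map_blockAverage hX hS j, Measure.map_apply (measurable_blockAverage hX.measurable hS j) hB]

theorem law_le_law_thickening (hX : IsStationary P X) (hS : Measurable (S n))
    (hR : Measurable (R n)) {ε : ℝ}
    (hSR : ∀ z, dist ((n : ℝ)⁻¹ • S n z) ((n : ℝ)⁻¹ • R n z) < ε)
    {U : Set Y} (hU : MeasurableSet U) :
    law P X S n U ≤ law P X R n (Metric.thickening ε U) := by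
  rw [← measure_blockAverage_preimage hX hS 1 hU,
    ← measure_blockAverage_preimage hX hR 1 Metric.isOpen_thickening.measurableSet]
  exact measure_mono fun ω hω =>
    Metric.mem_thickening_iff.2 ⟨_, hω, (dist_comm _ _).trans_lt (hSR _)⟩

theorem measurable_empirical (hX : ∀ i, Measurable (X i)) (hS : Measurable (S n)) {B : Set Y}
    (hB : MeasurableSet B) : Measurable fun ω => empirical k X S ω n B := by
  simp only [empirical_apply _ hB]
  exact (Finset.measurable_fun_sum _ fun j _ =>
    (measurable_one.indicator hB).comp (measurable_blockAverage hX hS j)).const_mul _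

theorem lintegral_empirical_le (hX : IsStationary P X) (hS : Measurable (S n)) {B : Set Y}
    (hB : MeasurableSet B) : ∫⁻ ω, empirical k X S ω n B ∂P ≤ law P X S n B := by
  have h_indicator (j : ℕ) : Measurable fun ω =>
      B.indicator (1 : Y → ℝ≥0∞) (blockAverage X S n j ω) :=
    (measurable_one.indicator hB).comp (measurable_blockAverage hX.measurable hS j)
  have h_lintegral (j : ℕ) :
      ∫⁻ ω, B.indicator 1 (blockAverage X S n j ω) ∂P = law P X S n B := by
    rw [← measure_blockAverage_preimage hX hS j hB,
      ← lintegral_indicator_one (measurable_blockAverage hX.measurable hS j hB)]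
    rfl
  calc ∫⁻ ω, empirical k X S ω n B ∂P
      = (k n : ℝ≥0∞)⁻¹ * ∑ _j ∈ Finset.Icc 1 (k n), law P X S n B := by
        simp only [empirical_apply _ hB]
        rw [lintegral_const_mul _ (Finset.measurable_fun_sum _ fun j _ => h_indicator j),
          lintegral_finsetSum _ fun j _ => h_indicator j]
        simp only [h_lintegral]
    _ = (k n : ℝ≥0∞)⁻¹ * k n * law P X S n B := by
        rw [Finset.sum_const, Nat.card_Icc, Nat.add_sub_cancel, nsmul_eq_mul, mul_assoc]
    _ ≤ law P X S n B := mul_le_of_le_one_left' (ENNReal.inv_mul_le_one _)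

theorem ae_expGrowthSup_empirical_le [IsFiniteMeasure P] (hX : IsStationary P X)
    (hS : ∀ n, 1 ≤ n → Measurable (S n)) {B : Set Y} (hB : MeasurableSet B) :
    ∀ᵐ ω ∂P, expGrowthSup (fun n => empirical k X S ω n B) ≤
      expGrowthSup (fun n => law P X S n B) := by
  have h_mean : expGrowthSup (fun n => ∫⁻ ω, empirical k X S ω n B ∂P) ≤
      expGrowthSup (fun n => law P X S n B) :=
    expGrowthSup_eventually_monotone ((eventually_ge_atTop 1).mono fun n hn =>
      lintegral_empirical_le hX (hS n hn) hB)
  filter_upwards [ae_expGrowthSup_le_expGrowthSup_lintegral ((eventually_ge_atTop 1).mono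
    fun n hn => (measurable_empirical hX.measurable (hS n hn) hB).aemeasurable)] with ω hω
  exact hω.trans h_mean

theorem ae_exponentiallyTight_empirical [IsFiniteMeasure P] (hX : IsStationary P X)
    (hS : ∀ n, 1 ≤ n → Measurable (S n)) (h : ExponentiallyTight (law P X S)) :
    ∀ᵐ ω ∂P, ExponentiallyTight (empirical k X S ω) := by
  choose K hK hK_law using h
  have h_nat : ∀ᵐ ω ∂P, ∀ a : ℕ, expGrowthSup (fun n => empirical k X S ω n (K a)ᶜ) ≤
      expGrowthSup (fun n => law P X S n (K a)ᶜ) :=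
    ae_all_iff.2 fun a => ae_expGrowthSup_empirical_le hX hS (hK a).measurableSet.compl
  filter_upwards [h_nat] with ω hω a
  obtain ⟨b, hab⟩ := exists_nat_ge a
  exact ⟨K b, hK b, (hω b).trans ((hK_law b).trans
    (EReal.coe_le_coe_iff.2 (neg_le_neg hab)))⟩

theorem ae_upperBound_empirical [IsFiniteMeasure P] [SecondCountableTopology Y]
    (hX : IsStationary P X) (hS : ∀ n, 1 ≤ n → Measurable (S n)) {I : Y → ℝ≥0∞}
    (hI : LowerSemicontinuous I) (hlaw : ∀ U, IsOpen U → UpperBound (law P X S) I U) :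
    ∀ᵐ ω ∂P, ∀ K, IsCompact K → UpperBound (empirical k X S ω) I K := by
  have hℬ := TopologicalSpace.isBasis_countableBasis Y
  have h_basis : ∀ᵐ ω ∂P, ∀ B ∈ TopologicalSpace.countableBasis Y,
      expGrowthSup (fun n => empirical k X S ω n B) ≤ expGrowthSup (fun n => law P X S n B) :=
    (ae_ball_iff (TopologicalSpace.countable_countableBasis Y)).2 fun B hB =>
      ae_expGrowthSup_empirical_le hX hS (hℬ.isOpen hB).measurableSet
  filter_upwards [h_basis] with ω hω K hK
  exact upperBound_of_isCompact hℬ hI (fun B hB => (hω B hB).trans (hlaw B (hℬ.isOpen hB))) hK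

end Empirical

section LowerBound

theorem exists_gap_expGrowthSup_neg {a k u : ℕ → ℝ≥0∞}
    (ha : ∀ δ : ℝ, 0 < δ → expGrowthSup (fun n : ℕ => a ⌈Real.exp (δ * n)⌉₊) = ⊥)
    (hk : -expGrowthInf u < expGrowthInf k) :
    ∃ m : ℕ → ℕ, (∀ n, m n ≠ 0) ∧
      expGrowthSup (fun n => m n / (k n * u n) + a (m n) / u n ^ 2) < 0 := by
  have h_pos : 0 < expGrowthInf fun n => k n * u n := by
    refine lt_of_lt_of_le ?_ (le_expGrowthInf_mul (u := k) (v := u))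
    simpa only [sub_eq_add_neg, neg_neg] using EReal.sub_pos.2 hk
  have h_sq : expGrowthInf (fun n => u n ^ 2) ≠ ⊥ := by
    have hu : expGrowthInf u ≠ ⊥ := fun h => by simp [h] at hk
    simp only [sq]
    refine ne_bot_of_le_ne_bot ?_ (le_expGrowthInf_mul (u := u) (v := u))
    simpa only [Ne, EReal.add_eq_bot_iff, or_self] using hu
  obtain ⟨δ, hδ0, hδ⟩ := EReal.lt_iff_exists_real_btwn.1 h_pos
  have hδ_pos : 0 < δ := EReal.coe_lt_coe_iff.1 hδ0
  refine ⟨fun n => ⌈Real.exp (δ * n)⌉₊, fun n => (Nat.ceil_pos.2 (Real.exp_pos _)).ne',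
    expGrowthSup_add.trans_lt (max_lt ?_ ?_)⟩
  · have h_gap := expGrowthSup_natCast_ceil_exp_le hδ_pos.le
    have h_gap_top := (h_gap.trans_lt (EReal.coe_lt_top δ)).ne
    exact (expGrowthSup_div_le (.inr h_pos.ne_bot) (.inl h_gap_top)).trans_lt
      ((EReal.sub_neg (.inl h_gap_top) (.inr h_pos.ne_bot)).2 (h_gap.trans_lt hδ))
  · refine (expGrowthSup_div_le (.inr h_sq) (.inl ?_)).trans_lt ?_ <;> rw [ha δ hδ_pos]
    · exact bot_ne_top
    · rw [EReal.bot_sub]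
      exact EReal.bot_lt_zero

variable {Ω E Y : Type*} [MeasurableSpace E] [NormedAddCommGroup Y]
  [NormedSpace ℝ Y] [MeasurableSpace Y] [BorelSpace Y] {X : ℕ → Ω → E}
  {R : ℕ → (ℕ → E) → Y} {k : ℕ → ℕ} {n : ℕ}

theorem measurableSet_sigmaPast_blockAverage (hR : Measurable (R n))
    (hRn : DependsOn (R n) (Set.Iio (2 * n))) (j : ℕ) {B : Set Y} (hB : MeasurableSet B) :
    MeasurableSet[sigmaPast X ((j - 1) * n + 2 * n)] (blockAverage X R n j ⁻¹' B) := by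
  refine (@measurable_comp_of_dependsOn _ _ _ _ (sigmaPast X _) _ _ _ hR _ hRn
    (fun ω => shift ((j - 1) * n) (path X ω)) fun i hi => ?_).const_smul (n : ℝ)⁻¹ hB
  have : i < 2 * n := hi
  exact measurable_iff_comap_le.2 (le_iSup₂_of_le (i + (j - 1) * n) (by lia) le_rfl)

theorem measurableSet_sigmaFuture_blockAverage (hR : Measurable (R n)) (j : ℕ) {B : Set Y}
    (hB : MeasurableSet B) :
    MeasurableSet[sigmaFuture X ((j - 1) * n)] (blockAverage X R n j ⁻¹' B) := by
  refine ((hR.comp (@measurable_pi_lambda _ _ _ (sigmaFuture X _) _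
    (fun ω => shift ((j - 1) * n) (path X ω)) fun i => ?_)).const_smul (n : ℝ)⁻¹) hB
  exact measurable_iff_comap_le.2 (le_iSup₂_of_le (i + (j - 1) * n) (by lia) le_rfl)

variable [MeasurableSpace Ω] {P : Measure Ω} [IsProbabilityMeasure P]

theorem real_inter_blockAverage_sub_le (hX : ∀ i, Measurable (X i)) (hR : Measurable (R n))
    (hRn : DependsOn (R n) (Set.Iio (2 * n))) (hn : n ≠ 0) {m : ℕ} (hm : m ≠ 0) {B : Set Y}
    (hB : MeasurableSet B) {i j : ℕ} (hi : 1 ≤ i) (hij : i + (m + 2) ≤ j) :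
    P.real (blockAverage X R n i ⁻¹' B ∩ blockAverage X R n j ⁻¹' B) -
        P.real (blockAverage X R n i ⁻¹' B) * P.real (blockAverage X R n j ⁻¹' B) ≤
      (alphaMixing P X m).toReal := by
  have h_gap : (i - 1) * n + 2 * n + m ≤ (j - 1) * n := by
    have h_index : i - 1 + (2 + m) ≤ j - 1 := by lia
    have h_blocks := Nat.mul_le_mul_right n h_index
    nlinarith [Nat.pos_of_ne_zero hn]
  have h_alpha := ofReal_abs_le_alphaMixing (P := P) (X := X) hm h_gap
    (measurableSet_sigmaPast_blockAverage hR hRn i hB)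
    (measurableSet_sigmaFuture_blockAverage hR j hB)
  rw [ENNReal.ofReal_le_iff_le_toReal
    ((alphaMixing_le_half hX m).trans_lt (by norm_num)).ne] at h_alpha
  exact (le_abs_self _).trans ((abs_sub_comm _ _).trans_le h_alpha)

theorem measure_empirical_le_half (hX : IsStationary P X) (hR : Measurable (R n))
    (hRn : DependsOn (R n) (Set.Iio (2 * n))) (hn : n ≠ 0) {m : ℕ} (hm : m ≠ 0) {B : Set Y}
    (hB : MeasurableSet B) :
    P {ω | empirical k X R ω n B ≤ law P X R n B / 2} ≤
      8 * (m + 2) / (k n * law P X R n B) + 4 * alphaMixing P X m / law P X R n B ^ 2 := by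
  rcases eq_or_ne (law P X R n B) 0 with hq | hq
  · simp [hq, ENNReal.div_zero]
  rcases eq_or_ne (k n) 0 with hk | hk
  · simp [hk, ENNReal.div_zero]
  have hA (j : ℕ) : MeasurableSet (blockAverage X R n j ⁻¹' B) :=
    measurable_blockAverage hX.measurable hR j hB
  have hq_top : law P X R n B ≠ ⊤ := by
    rw [← measure_blockAverage_preimage hX hR 1 hB]
    exact measure_ne_top P _
  set p := (law P X R n B).toReal
  have hp : 0 < p := ENNReal.toReal_pos hq hq_top
  have hP (j : ℕ) : P.real (blockAverage X R n j ⁻¹' B) = p := by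
    rw [measureReal_def, measure_blockAverage_preimage hX hR j hB]
  have hk0 : (0 : ℝ) < k n := by exact_mod_cast Nat.pos_of_ne_zero hk
  have h_second := measure_sum_indicator_one_le_half (P := P) (s := Finset.Icc 1 (k n))
    (fun j _ => hA j) ENNReal.toReal_nonneg
    (fun i hi j _ hij => real_inter_blockAverage_sub_le hX.measurable hR hRn hn hm hB
      (Finset.mem_Icc.1 hi).1 hij) (fun j _ => hP j) hp
    (Finset.nonempty_Icc.2 (Nat.pos_of_ne_zero hk))
  rw [Nat.card_Icc, Nat.add_sub_cancel, ENNReal.ofReal_toReal hq_top, ENNReal.ofReal_toReal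
    ((alphaMixing_le_half hX.measurable m).trans_lt (by norm_num)).ne, Nat.cast_add,
    Nat.cast_ofNat] at h_second
  refine (measure_mono fun ω (hω : empirical k X R ω n B ≤ _) => ?_).trans h_second
  have h_real := ENNReal.toReal_mono (ENNReal.div_ne_top hq_top two_ne_zero) hω
  rw [toReal_empirical_apply ω hB, inv_mul_le_iff₀ hk0, ENNReal.toReal_div] at h_real
  exact h_real.trans_eq (by rw [mul_div_assoc]; rfl)

theorem expGrowthSup_measure_empirical_le_half_neg (hX : IsStationary P X)
    (hR : ∀ n, 1 ≤ n → Measurable (R n)) (hRn : ∀ n, DependsOn (R n) (Set.Iio (2 * n)))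
    (hmix : ∀ h : ℝ, 0 < h → mixingMoment P X h < ⊤) {B : Set Y} (hB : MeasurableSet B)
    (hk : -expGrowthInf (fun n => law P X R n B) < expGrowthInf (fun n => (k n : ℝ≥0∞))) :
    expGrowthSup (fun n => P {ω | empirical k X R ω n B ≤ law P X R n B / 2}) < 0 := by
  obtain ⟨m, hm, h_neg⟩ := exists_gap_expGrowthSup_neg
    (fun δ => expGrowthSup_alphaMixing_ceil_exp hX.measurable hmix) hk
  refine (expGrowthSup_le_of_eventually_le (b := 24) (by simp)
    ((eventually_ge_atTop 1).mono fun n hn => ?_)).trans_lt h_neg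
  have h_gap : 8 * ((m n : ℝ≥0∞) + 2) ≤ 24 * m n := by
    have h_one : 1 ≤ m n := Nat.one_le_iff_ne_zero.2 (hm n)
    exact_mod_cast (by lia : 8 * (m n + 2) ≤ 24 * m n)
  calc P {ω | empirical k X R ω n B ≤ law P X R n B / 2}
      ≤ 8 * (m n + 2) / (k n * law P X R n B) + 4 * alphaMixing P X (m n) / law P X R n B ^ 2 :=
        measure_empirical_le_half hX (hR n hn) (hRn n) (Nat.one_le_iff_ne_zero.1 hn) (hm n) hB
    _ ≤ 24 * m n / (k n * law P X R n B) +
          24 * alphaMixing P X (m n) / law P X R n B ^ 2 := by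
        gcongr
        norm_num
    _ = 24 * (m n / (k n * law P X R n B) + alphaMixing P X (m n) / law P X R n B ^ 2) := by
        rw [mul_add, mul_div_assoc, mul_div_assoc]

theorem ae_expGrowthInf_law_le_empirical_of_dependsOn (hX : IsStationary P X)
    (hR : ∀ n, 1 ≤ n → Measurable (R n)) (hRn : ∀ n, DependsOn (R n) (Set.Iio (2 * n)))
    (hmix : ∀ h : ℝ, 0 < h → mixingMoment P X h < ⊤) {B : Set Y} (hB : MeasurableSet B)
    (hk : -expGrowthInf (fun n => law P X R n B) < expGrowthInf (fun n => (k n : ℝ≥0∞))) :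
    ∀ᵐ ω ∂P, expGrowthInf (fun n => law P X R n B) ≤
      expGrowthInf (fun n => empirical k X R ω n B) := by
  filter_upwards [ae_eventually_notMem_of_expGrowthSup_neg
    (expGrowthSup_measure_empirical_le_half_neg hX hR hRn hmix hB hk)] with ω hω
  refine expGrowthInf_of_eventually_ge (b := 2⁻¹) (by simp) (hω.mono fun n hn => ?_)
  rw [mul_comm, ← div_eq_mul_inv]
  exact (not_le.1 hn).le

end LowerBound

section Approximation

variable {Ω E Y : Type*} [NormedAddCommGroup Y] [NormedSpace ℝ Y]
  {R S : ℕ → (ℕ → E) → Y} {n : ℕ} {ε : ℝ}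

theorem UniformlyApproximable.eventually_dist_lt (h : UniformlyApproximable S) (e : ℕ → E)
    (hε : 0 < ε) : ∀ᶠ n : ℕ in atTop, ∀ z : ℕ → E,
      dist ((n : ℝ)⁻¹ • S n z) ((n : ℝ)⁻¹ • S n ((Set.Iio (2 * n)).piecewise z e)) < ε := by
  obtain ⟨R, hRn, hR⟩ := h
  have h_small := (tendsto_order.1 hR).2 (ENNReal.ofReal (ε / 2)) (by simpa using hε)
  filter_upwards [h_small, eventually_ge_atTop 1] with n hn hn1 z
  have hn0 : (0 : ℝ) < n := by exact_mod_cast hn1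
  have h_dist (z : ℕ → E) : dist ((n : ℝ)⁻¹ • S n z) ((n : ℝ)⁻¹ • R n z) < ε / 2 := by
    have hz := (le_iSup (fun z : ℕ → E => ‖S n z - R n z‖ₑ / (n : ℝ≥0∞)) z).trans_lt hn
    rw [← ofReal_norm, ← ENNReal.ofReal_natCast, ← ENNReal.ofReal_div_of_pos hn0,
      ENNReal.ofReal_lt_ofReal_iff (by positivity)] at hz
    rwa [dist_smul₀, dist_eq_norm, norm_inv, Real.norm_natCast, inv_mul_eq_div]
  have hRz : R n z = R n ((Set.Iio (2 * n)).piecewise z e) :=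
    hRn n fun i hi => (Set.piecewise_eq_of_mem _ _ _ hi).symm
  calc dist ((n : ℝ)⁻¹ • S n z) ((n : ℝ)⁻¹ • S n ((Set.Iio (2 * n)).piecewise z e))
      ≤ dist ((n : ℝ)⁻¹ • S n z) ((n : ℝ)⁻¹ • R n z) +
          dist ((n : ℝ)⁻¹ • S n ((Set.Iio (2 * n)).piecewise z e))
            ((n : ℝ)⁻¹ • R n ((Set.Iio (2 * n)).piecewise z e)) := by
        rw [← hRz]
        exact dist_triangle_right _ _ _
    _ < ε := (add_lt_add (h_dist _) (h_dist _)).trans_eq (add_halves ε)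

variable [MeasurableSpace Y] [MeasurableSpace E]

theorem UniformlyApproximable.exists_measurable [Nonempty E] (h : UniformlyApproximable S)
    (hS : ∀ n, 1 ≤ n → Measurable (S n)) :
    ∃ R : ℕ → (ℕ → E) → Y, (∀ n, 1 ≤ n → Measurable (R n)) ∧
      (∀ n, DependsOn (R n) (Set.Iio (2 * n))) ∧ ∀ ε > 0, ∀ᶠ n : ℕ in atTop, ∀ z,
        dist ((n : ℝ)⁻¹ • S n z) ((n : ℝ)⁻¹ • R n z) < ε := by
  obtain ⟨e⟩ : Nonempty (ℕ → E) := inferInstance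
  refine ⟨fun n z => S n ((Set.Iio (2 * n)).piecewise z e), fun n hn => ?_, fun n z w hzw => ?_,
    fun ε hε => h.eventually_dist_lt e hε⟩
  · refine (hS n hn).comp (measurable_pi_lambda _ fun i => ?_)
    by_cases hi : i ∈ Set.Iio (2 * n)
    · simpa only [Set.piecewise_eq_of_mem _ _ _ hi] using measurable_pi_apply i
    · simp only [Set.piecewise_eq_of_notMem _ _ _ hi, measurable_const]
  · refine congrArg (S n) (funext fun i => ?_)
    by_cases hi : i ∈ Set.Iio (2 * n)
    · simp only [Set.piecewise_eq_of_mem _ _ _ hi, hzw i hi]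
    · simp only [Set.piecewise_eq_of_notMem _ _ _ hi]

variable [BorelSpace Y] [MeasurableSpace Ω] {P : Measure Ω} {X : ℕ → Ω → E} {k : ℕ → ℕ}

theorem ae_expGrowthInf_law_le_empirical_thickening [IsProbabilityMeasure P]
    (hX : IsStationary P X) (hS : ∀ n, 1 ≤ n → Measurable (S n)) (hSR : UniformlyApproximable S)
    (hmix : ∀ h : ℝ, 0 < h → mixingMoment P X h < ⊤) {U : Set Y} (hU : MeasurableSet U)
    (hε : 0 < ε)
    (hk : -expGrowthInf (fun n => law P X S n U) < expGrowthInf (fun n => (k n : ℝ≥0∞))) :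
    ∀ᵐ ω ∂P, expGrowthInf (fun n => law P X S n U) ≤
      expGrowthInf (fun n => empirical k X S ω n (Metric.thickening ε U)) := by
  obtain ⟨ω₀⟩ := nonempty_of_isProbabilityMeasure P
  have : Nonempty E := ⟨X 0 ω₀⟩
  obtain ⟨R, hR, hRn, h_close⟩ := hSR.exists_measurable hS
  set V := Metric.thickening (ε / 2) U
  have hV : MeasurableSet V := Metric.isOpen_thickening.measurableSet
  have h_law : expGrowthInf (fun n => law P X S n U) ≤ expGrowthInf (fun n => law P X R n V) := by
    refine expGrowthInf_eventually_monotone ?_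
    filter_upwards [h_close _ (half_pos hε), eventually_ge_atTop 1] with n hn hn1
    exact law_le_law_thickening hX (hS n hn1) (hR n hn1) hn hU
  filter_upwards [ae_expGrowthInf_law_le_empirical_of_dependsOn hX hR hRn hmix hV
    ((EReal.neg_le_neg_iff.2 h_law).trans_lt hk)] with ω hω
  refine h_law.trans (hω.trans (expGrowthInf_eventually_monotone ?_))
  filter_upwards [h_close _ (half_pos hε)] with n hn
  calc empirical k X R ω n V ≤ empirical k X S ω n (Metric.thickening (ε / 2) V) :=
        empirical_le_empirical_thickening (fun z => (dist_comm _ _).trans_lt (hn z)) ω hV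
    _ ≤ empirical k X S ω n (Metric.thickening ε U) :=
        measure_mono ((Metric.thickening_thickening_subset _ _ _).trans_eq (by rw [add_halves]))

theorem ae_lowerBound_empirical [IsProbabilityMeasure P] [SecondCountableTopology Y]
    (hX : IsStationary P X) (hS : ∀ n, 1 ≤ n → Measurable (S n)) (hSR : UniformlyApproximable S)
    (hmix : ∀ h : ℝ, 0 < h → mixingMoment P X h < ⊤) {I : Y → ℝ≥0∞}
    (hlaw : ∀ U, IsOpen U → LowerBound (law P X S) I U)
    (hk : ∀ x ∈ rateDomain I, (I x : EReal) < expGrowthInf (fun n => (k n : ℝ≥0∞))) :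
    ∀ᵐ ω ∂P, ∀ Γ, LowerBound (empirical k X S ω) I Γ := by
  have hℬ := TopologicalSpace.isBasis_countableBasis Y
  have h_basis : ∀ᵐ ω ∂P, ∀ U ∈ TopologicalSpace.countableBasis Y, ∀ m : ℕ,
      -expGrowthInf (fun n => law P X S n U) < expGrowthInf (fun n => (k n : ℝ≥0∞)) →
      expGrowthInf (fun n => law P X S n U) ≤
        expGrowthInf (fun n => empirical k X S ω n (Metric.thickening (1 / (m + 1 : ℝ)) U)) :=
    (ae_ball_iff (TopologicalSpace.countable_countableBasis Y)).2 fun U hU =>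
      ae_all_iff.2 fun m => eventually_imp_distrib_left.2 fun hkU =>
        ae_expGrowthInf_law_le_empirical_thickening hX hS hSR hmix (hℬ.isOpen hU).measurableSet
          (by positivity) hkU
  filter_upwards [h_basis] with ω hω Γ
  refine lowerBound_iff.2 fun x hx => ?_
  rcases eq_or_ne (I x) ⊤ with hIx | hIx
  · simp [hIx]
  obtain ⟨ε, hε, h_ball⟩ := Metric.mem_nhds_iff.1 (mem_interior_iff_mem_nhds.1 hx)
  obtain ⟨m, hm⟩ := exists_nat_one_div_lt (half_pos hε)
  obtain ⟨U, hU, hxU, hU_ball⟩ := hℬ.mem_nhds_iff.1 (Metric.ball_mem_nhds x (half_pos hε))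
  have h_law : -(I x : EReal) ≤ expGrowthInf (fun n => law P X S n U) :=
    lowerBound_iff.1 (hlaw U (hℬ.isOpen hU)) x ((hℬ.isOpen hU).interior_eq.symm ▸ hxU)
  have h_thickening : Metric.thickening (1 / (m + 1 : ℝ)) U ⊆ Γ := by
    refine fun y hy => h_ball ?_
    obtain ⟨w, hw, hyw⟩ := Metric.mem_thickening_iff.1 hy
    have := dist_triangle y w x
    have : dist w x < ε / 2 := hU_ball hw
    rw [Metric.mem_ball]
    linarith
  calc -(I x : EReal) ≤ expGrowthInf (fun n => law P X S n U) := h_law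
    _ ≤ expGrowthInf (fun n => empirical k X S ω n (Metric.thickening (1 / (m + 1 : ℝ)) U)) :=
        hω U hU m ((EReal.neg_le.1 h_law).trans_lt (hk x (lt_top_iff_ne_top.2 hIx)))
    _ ≤ expGrowthInf (fun n => empirical k X S ω n Γ) :=
        expGrowthInf_monotone fun n => measure_mono h_thickening

end Approximation

theorem lt_expGrowthInf_natCast {Y : Type*} {I : Y → ℝ≥0∞} {k : ℕ → ℕ}
    (hk_pos : ∀ n, 1 ≤ n → 0 < k n)
    (hk : ((⨆ x ∈ rateDomain I, I x : ℝ≥0∞) : EReal) <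
        liminf (fun n : ℕ => ((Real.log (k n) / n : ℝ) : EReal)) atTop ∨
      Tendsto (fun n : ℕ => Real.log (k n) / n) atTop atTop) {x : Y} (hx : x ∈ rateDomain I) :
    (I x : EReal) < expGrowthInf (fun n => (k n : ℝ≥0∞)) := by
  have h_growth : expGrowthInf (fun n => (k n : ℝ≥0∞)) =
      liminf (fun n : ℕ => ((Real.log (k n) / n : ℝ) : EReal)) atTop := by
    refine liminf_congr ((eventually_ge_atTop 1).mono fun n hn => ?_)
    beta_reduce
    rw [EReal.coe_div, EReal.coe_natCast, ← ENNReal.ofReal_natCast,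
      ENNReal.log_ofReal_of_pos (by exact_mod_cast hk_pos n hn)]
  rw [h_growth]
  rcases hk with hk | hk
  · exact (EReal.coe_ennreal_le_coe_ennreal_iff.2 (le_biSup I hx)).trans_lt hk
  · rw [(EReal.tendsto_coe_nhds_top_iff.2 hk).liminf_eq]
    exact (EReal.coe_ennreal_lt_coe_ennreal_iff.2 hx)

end LocalLDP

theorem theorem2p2_general
    {Ω E Y : Type*} [MeasurableSpace Ω] [MeasurableSpace E]
    [NormedAddCommGroup Y] [NormedSpace ℝ Y] [TopologicalSpace.SeparableSpace Y]
    [MeasurableSpace Y] [BorelSpace Y]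
    (P : Measure Ω) [IsProbabilityMeasure P]
    (X : ℕ → Ω → E) (hX : LocalLDP.IsStationary P X)
    (S : ℕ → (ℕ → E) → Y) (hS : ∀ n, 1 ≤ n → Measurable (S n))
    (k : ℕ → ℕ) (I : Y → ℝ≥0∞)
    (hA1 : LocalLDP.SatisfiesLDP (LocalLDP.law P X S) I)
    (hA2 : ∀ h : ℝ, 0 < h → LocalLDP.mixingMoment P X h < ⊤)
    (hA3 : LocalLDP.UniformlyApproximable S)
    (hk : ∀ x ∈ LocalLDP.rateDomain I,
      (I x : EReal) < ExpGrowth.expGrowthInf (fun n => (k n : ℝ≥0∞))) :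
    (∀ᵐ ω ∂P, LocalLDP.SatisfiesWeakLDP (LocalLDP.empirical k X S ω) I) ∧
    (LocalLDP.ExponentiallyTight (LocalLDP.law P X S) →
      LocalLDP.IsGoodRate I ∧
        ∀ᵐ ω ∂P, LocalLDP.SatisfiesLDP (LocalLDP.empirical k X S ω) I) := by
  have : SecondCountableTopology Y := UniformSpace.secondCountable_of_separable Y
  have h_open (U : Set Y) (hU : IsOpen U) : LocalLDP.InCompletedBorel (LocalLDP.law P X S) U :=
    fun _ _ => hU.measurableSet.nullMeasurableSet
  have h_lower (U : Set Y) (hU : IsOpen U) := hA1.lower U (h_open U hU)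
  have h_upper (U : Set Y) (hU : IsOpen U) := hA1.upper U (h_open U hU)
  have h_weak : ∀ᵐ ω ∂P, LocalLDP.SatisfiesWeakLDP (LocalLDP.empirical k X S ω) I := by
    filter_upwards [LocalLDP.ae_lowerBound_empirical hX hS hA3 hA2 h_lower hk,
      LocalLDP.ae_upperBound_empirical hX hS hA1.lsc h_upper] with ω hω_lower hω_upper
    exact ⟨hA1.lsc, fun Γ _ => hω_lower Γ, hω_upper⟩
  refine ⟨h_weak, fun h_tight => ⟨h_tight.isGoodRate hA1.lsc h_lower, ?_⟩⟩
  filter_upwards [h_weak, LocalLDP.ae_exponentiallyTight_empirical hX hS h_tight] with ω hω h_tightω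
  exact hω.satisfiesLDP h_tightω

theorem theorem2p2
    {Ω E Y : Type*} [MeasurableSpace Ω] [MeasurableSpace E]
    [NormedAddCommGroup Y] [NormedSpace ℝ Y] [TopologicalSpace.SeparableSpace Y]
    [MeasurableSpace Y] [BorelSpace Y]
    (P : Measure Ω) [IsProbabilityMeasure P]
    (X : ℕ → Ω → E) (hX : LocalLDP.IsStationary P X)
    (S : ℕ → (ℕ → E) → Y) (hS : ∀ n, 1 ≤ n → Measurable (S n))
    (k : ℕ → ℕ) (hk_pos : ∀ n, 1 ≤ n → 0 < k n) (hk_mono : MonotoneOn k (Set.Ici 1))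
    (I : Y → ℝ≥0∞)
    (hA1 : LocalLDP.SatisfiesLDP (LocalLDP.law P X S) I)
    (hA2 : ∀ h : ℝ, 0 < h → LocalLDP.mixingMoment P X h < ⊤)
    (hA3 : LocalLDP.UniformlyApproximable S)
    (hk :
      ((⨆ x ∈ LocalLDP.rateDomain I, I x) < ⊤ ∧
        ((⨆ x ∈ LocalLDP.rateDomain I, I x : ℝ≥0∞) : EReal) <
          liminf (fun n : ℕ => ((Real.log (k n) / n : ℝ) : EReal)) atTop) ∨
      Tendsto (fun n : ℕ => Real.log (k n) / n) atTop atTop) :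
    (∀ᵐ ω ∂P, LocalLDP.SatisfiesWeakLDP (LocalLDP.empirical k X S ω) I) ∧
    (LocalLDP.ExponentiallyTight (LocalLDP.law P X S) →
      LocalLDP.IsGoodRate I ∧
        ∀ᵐ ω ∂P, LocalLDP.SatisfiesLDP (LocalLDP.empirical k X S ω) I) :=
  theorem2p2_general P X hX S hS k I hA1 hA2 hA3 fun _ =>
    LocalLDP.lt_expGrowthInf_natCast hk_pos (hk.imp_left And.right)
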